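/- Let $\mathbb F$ be a division ring, $\sigma:\mathbb F\to\mathbb F$ a (unital) ring endomorphism and $\delta:\mathbb F\to\mathbb F$ a $\sigma$-derivation, i.e. an additive map with $\delta(ab)=\sigma(a)\delta(b)+\delta(a)b$ for all $a,b\in\mathbb F$. Let $\mathbb F[x;\sigma,\delta]$ be the ring of skew polynomials $\sum_i a_ix^i$ with the usual addition and the product determined by $xa=\sigma(a)x+\delta(a)$. For $d,s\ge 0$ let $\mathcal C_{d,s}(a)$ be the sum of all compositions of $d$ copies of $\delta$ and $s$ copies of $\sigma$, evaluated at $a$ (so $\mathcal C_{0,0}(a)=a$). Let $f=\sum_{j=0}^m a_jx^j$ and $g=\sum_{j=0}^n b_jx^j$ be non-constant elements of $\mathbb F[x;\sigma,\delta]$ of degrees $m$ and $n$. Their right $(\sigma,\delta)$-Sylvester matrix is the $(m+n)\times(m+n)$ matrix with rows and columns counted from $0$, whose entry in column $q$ is $\sum_{l=0}^{p}\mathcal C_{p-l,l}(a_{q-l})$ in row $p$ for $0\le p<n$, and $\sum_{l=0}^{p}\mathcal C_{p-l,l}(b_{q-l})$ in row $n+p$ for $0\le p<m$ (coefficients with index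 outside the range are $0$). Their right $(\sigma,\delta)$-resultant $R^{\sigma,\delta}_{\mathbb F}(f,g)\in\{0\}\cup\mathbb F^*/[\mathbb F^*,\mathbb F^*]$ is the Dieudonné determinant of this matrix. Let $\tilde{\mathbb F}$ be a ring containing $\mathbb F$ as a subring (for instance a division ring), $\tilde\sigma$ a ring endomorphism of $\tilde{\mathbb F}$ with $\tilde\sigma|_{\mathbb F}=\sigma$, and $\tilde\delta$ a $\tilde\sigma$-derivation of $\tilde{\mathbb F}$ with $\tilde\delta|_{\mathbb F}=\delta$, so that $\tilde{\mathbb F}[x;\tilde\sigma,\tilde\delta]$ is a polynomial ring extension of $\mathbb F[x;\sigma,\delta]$. An element $\alpha\in\tilde{\mathbb F}$ is a right root of $h\in\tilde{\mathbb F}[x;\tilde\sigma,\tilde\delta]$ if the unique remainder $r\in\tilde{\mathbb F}$ in $h=q\,(x-\alpha)+r$ is $0$. If $f$ and $g$ have a common right root $\alpha\in\tilde{\mathbb F}$ in some such polynomial ring extension, then $R^{\sigma,\delta}_{\mathbb F}(f,g)=0$. -/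

import Mathlib

/-! Skew polynomial rings (Ore extensions) in one variable, right evaluation, the Sylvester
matrix of two skew polynomials, the Dieudonné determinant and the right resultant. -/

/-- A `σ`-derivation of a ring `R`, for a ring endomorphism `σ`: an additive map `δ` with
`δ (a * b) = σ a * δ b + δ a * b`. -/
structure SkewDerivation {R : Type*} [Ring R] (σ : R →+* R) where
  toAddHom : R →+ R
  leibniz : ∀ a b : R, toAddHom (a * b) = σ a * toAddHom b + toAddHom a * b

instance {R : Type*} [Ring R] (σ : R →+* R) : CoeFun (SkewDerivation σ) (fun _ => R → R) :=
  ⟨fun δ => δ.toAddHom⟩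

/-- The skew polynomial ring `R[x; σ, δ]`. Its elements are the polynomials `∑ aᵢ xⁱ` with
coefficients written on the left, added coefficientwise: a skew polynomial is its finitely
supported family of coefficients. The product, determined by `x a = σ a x + δ a`, is defined
below. -/
def OrePoly {R : Type*} [Ring R] (σ : R →+* R) (_δ : SkewDerivation σ) : Type _ := ℕ →₀ R

namespace OrePoly

section Basic

variable {R : Type*} [Ring R] {σ : R →+* R} {δ : SkewDerivation σ}

noncomputable instance : AddCommGroup (OrePoly σ δ) := inferInstanceAs (AddCommGroup (ℕ →₀ R))

noncomputable instance : Module R (OrePoly σ δ) := inferInstanceAs (Module R (ℕ →₀ R))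

/-- The coefficient of `xⁱ` (written on the left of `xⁱ`). -/
def coeff (f : OrePoly σ δ) (i : ℕ) : R := (show ℕ →₀ R from f) i

/-- The degree, with the convention that it is `0` for the zero polynomial; a skew polynomial is
non-constant exactly when this is positive. -/
def natDegree (f : OrePoly σ δ) : ℕ := (show ℕ →₀ R from f).support.sup id

/-- The monomial `a xⁱ`, as an additive function of `a`. -/
noncomputable def monomial (i : ℕ) : R →+ OrePoly σ δ := Finsupp.singleAddHom i

/-- The constant polynomial `a`. -/
noncomputable def C (a : R) : OrePoly σ δ := monomial 0 a

/-- The variable `x`. -/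
noncomputable def X : OrePoly σ δ := monomial 1 1

/-- Left multiplication by `x`, the additive map with `a xⁱ ↦ σ a xⁱ⁺¹ + δ a xⁱ`. -/
noncomputable def mulX : AddMonoid.End (OrePoly σ δ) :=
  (Finsupp.liftAddHom (M := R) (N := OrePoly σ δ) fun i =>
    (monomial (i + 1)).comp σ.toAddMonoidHom + (monomial i).comp δ.toAddHom :
      (ℕ →₀ R) →+ OrePoly σ δ)

/-- Left multiplication by a scalar. -/
noncomputable def mulC : R →+* AddMonoid.End (OrePoly σ δ) := Module.toAddMonoidEnd R _

/-- Left multiplication by `∑ aᵢ xⁱ`: the operator `∑ aᵢ (x ·)ⁱ`. -/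
noncomputable def mulLeft : OrePoly σ δ →+ AddMonoid.End (OrePoly σ δ) :=
  (Finsupp.liftAddHom (M := R) (N := AddMonoid.End (OrePoly σ δ)) fun i =>
    (AddMonoidHom.mulRight (mulX ^ i)).comp mulC.toAddMonoidHom :
      (ℕ →₀ R) →+ AddMonoid.End (OrePoly σ δ))

noncomputable instance : Mul (OrePoly σ δ) := ⟨fun f g => mulLeft f g⟩

noncomputable instance : One (OrePoly σ δ) := ⟨C 1⟩

theorem mul_def (f g : OrePoly σ δ) : f * g = mulLeft f g := rfl

theorem one_def : (1 : OrePoly σ δ) = monomial 0 1 := rfl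

theorem hom_ext {A : Type*} [AddMonoid A] {u v : OrePoly σ δ →+ A}
    (h : ∀ i a, u (monomial i a) = v (monomial i a)) : u = v :=
  Finsupp.addHom_ext (f := u) (g := v) h

theorem induction_linear {P : OrePoly σ δ → Prop} (f : OrePoly σ δ) (zero : P 0)
    (add : ∀ f g, P f → P g → P (f + g)) (mono : ∀ i a, P (monomial i a)) : P f :=
  Finsupp.induction_linear (motive := P) f zero add mono

theorem smul_monomial (a : R) (i : ℕ) (b : R) :
    a • (monomial i b : OrePoly σ δ) = monomial i (a * b) :=
  Finsupp.smul_single' a i b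

theorem mulX_monomial (i : ℕ) (a : R) :
    mulX (monomial i a : OrePoly σ δ) = monomial (i + 1) (σ a) + monomial i (δ a) :=
  Finsupp.liftAddHom_apply_single _ i a

theorem mulLeft_monomial (i : ℕ) (a : R) :
    mulLeft (monomial i a : OrePoly σ δ) = mulC a * mulX ^ i :=
  Finsupp.liftAddHom_apply_single _ i a

theorem map_one_eq_zero (δ : SkewDerivation σ) : δ 1 = 0 := by
  have h := δ.leibniz 1 1
  simpa using h

theorem mulX_mul_mulC (a : R) :
    (mulX * mulC a : AddMonoid.End (OrePoly σ δ)) = mulC (σ a) * mulX + mulC (δ a) := by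
  refine hom_ext fun i b => ?_
  change mulX (a • monomial i b) = σ a • mulX (monomial i b) + δ a • monomial i b
  simp only [smul_monomial, mulX_monomial, smul_add, map_mul, δ.leibniz, map_add]
  abel

theorem mulLeft_mulX (g : OrePoly σ δ) : mulLeft (mulX g) = mulX * mulLeft g := by
  suffices h : (mulLeft (σ := σ) (δ := δ)).comp mulX = (AddMonoidHom.mulLeft mulX).comp mulLeft from
    DFunLike.congr_fun h g
  refine hom_ext fun i a => ?_
  change mulLeft (mulX (monomial i a)) = mulX * mulLeft (monomial i a)
  rw [mulX_monomial, map_add, mulLeft_monomial, mulLeft_monomial, mulLeft_monomial, ← mul_assoc,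
    mulX_mul_mulC, add_mul, mul_assoc, pow_succ']

theorem mulLeft_smul (a : R) (g : OrePoly σ δ) : mulLeft (a • g) = mulC a * mulLeft g := by
  suffices h : (mulLeft (σ := σ) (δ := δ)).comp (mulC a) =
      (AddMonoidHom.mulLeft (mulC a)).comp mulLeft from DFunLike.congr_fun h g
  refine hom_ext fun i b => ?_
  change mulLeft (a • monomial i b) = mulC a * mulLeft (monomial i b)
  rw [smul_monomial, mulLeft_monomial, mulLeft_monomial, map_mul, mul_assoc]

theorem mulLeft_mulX_pow (i : ℕ) (g : OrePoly σ δ) :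
    mulLeft ((mulX ^ i) g) = mulX ^ i * mulLeft g := by
  induction i with
  | zero => simp
  | succ i ih =>
    rw [pow_succ', mul_assoc, ← ih, ← mulLeft_mulX]
    rfl

theorem mulLeft_mul (f g : OrePoly σ δ) : mulLeft (f * g) = mulLeft f * mulLeft g := by
  suffices h : (mulLeft (σ := σ) (δ := δ)).comp ((AddMonoidHom.eval g).comp mulLeft) =
      (AddMonoidHom.mulRight (mulLeft g)).comp mulLeft from DFunLike.congr_fun h f
  refine hom_ext fun i a => ?_
  change mulLeft (mulLeft (monomial i a) g) = mulLeft (monomial i a) * mulLeft g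
  rw [mulLeft_monomial, mul_assoc, ← mulLeft_mulX_pow]
  exact mulLeft_smul a _

theorem mulX_pow_one (i : ℕ) : (mulX ^ i) (1 : OrePoly σ δ) = monomial i 1 := by
  induction i with
  | zero => rfl
  | succ i ih =>
    rw [pow_succ']
    change mulX ((mulX ^ i) 1) = _
    rw [ih, mulX_monomial, map_one, map_one_eq_zero, map_zero, add_zero]

theorem mulLeft_one : mulLeft (1 : OrePoly σ δ) = 1 := by
  rw [one_def, mulLeft_monomial, map_one, pow_zero, one_mul]

theorem mulLeft_apply_one (f : OrePoly σ δ) : mulLeft f 1 = f := by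
  suffices h : (AddMonoidHom.eval (1 : OrePoly σ δ)).comp mulLeft = AddMonoidHom.id _ from
    DFunLike.congr_fun h f
  refine hom_ext fun i a => ?_
  change mulLeft (monomial i a) 1 = monomial i a
  rw [mulLeft_monomial]
  change a • (mulX ^ i) 1 = _
  rw [mulX_pow_one, smul_monomial, mul_one]

noncomputable instance : Ring (OrePoly σ δ) where
  __ := (inferInstance : AddCommGroup (OrePoly σ δ))
  mul := (· * ·)
  one := 1
  left_distrib f g h := map_add (mulLeft f) g h
  right_distrib f g h := by
    change mulLeft (f + g) h = mulLeft f h + mulLeft g h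
    rw [map_add]; rfl
  zero_mul f := by
    change mulLeft 0 f = 0
    rw [map_zero]; rfl
  mul_zero f := map_zero (mulLeft f)
  mul_assoc f g h := by
    change mulLeft (f * g) h = mulLeft f (mulLeft g h)
    rw [mulLeft_mul]; rfl
  one_mul f := by
    change mulLeft 1 f = f
    rw [mulLeft_one]; rfl
  mul_one f := mulLeft_apply_one f

/-- The defining commutation rule `x a = σ a x + δ a`. -/
theorem X_mul_C (a : R) : (X * C a : OrePoly σ δ) = C (σ a) * X + C (δ a) := by
  simp only [X, C, mul_def, mulLeft_monomial, map_one, one_mul, pow_one, pow_zero, mul_one,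
    mulX_monomial]
  change _ = σ a • monomial 1 1 + _
  rw [smul_monomial, mul_one]

theorem C_mul_eq_smul (a : R) (f : OrePoly σ δ) : C a * f = a • f := by
  rw [mul_def, C, mulLeft_monomial, pow_zero, mul_one]; rfl

theorem X_mul_eq_mulX (f : OrePoly σ δ) : X * f = mulX f := by
  rw [mul_def, X, mulLeft_monomial, map_one, one_mul, pow_one]

theorem C_add (a b : R) : (C (a + b) : OrePoly σ δ) = C a + C b := map_add (monomial 0) a b

/-- Division with remainder by `x - a` on the right. -/
theorem exists_eq_mul_X_sub_C_add_C (f : OrePoly σ δ) (a : R) :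
    ∃ r : R, ∃ q : OrePoly σ δ, f = q * (X - C a) + C r := by
  have hpow : ∀ i : ℕ, ∃ r : R, ∃ q : OrePoly σ δ, monomial i 1 = q * (X - C a) + C r := by
    intro i
    induction i with
    | zero => exact ⟨1, 0, by rw [zero_mul, zero_add]; rfl⟩
    | succ i ih =>
      obtain ⟨r, q, h⟩ := ih
      refine ⟨σ r * a + δ r, X * q + C (σ r), ?_⟩
      have h1 : (monomial (i + 1) 1 : OrePoly σ δ) = X * monomial i 1 := by
        rw [X_mul_eq_mulX, mulX_monomial, map_one σ, map_one_eq_zero, map_zero, add_zero]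
      have h2 : (C (σ r * a) : OrePoly σ δ) = C (σ r) * C a := by
        rw [C_mul_eq_smul, C, C, smul_monomial]
      rw [h1, h, mul_add, X_mul_C, C_add, h2]
      noncomm_ring
  refine induction_linear (P := fun f => ∃ r : R, ∃ q : OrePoly σ δ, f = q * (X - C a) + C r)
    f ?_ ?_ ?_
  · refine ⟨0, 0, ?_⟩
    rw [zero_mul, zero_add]; exact (map_zero (monomial 0)).symm
  · rintro f g ⟨r, q, h⟩ ⟨s, p, h'⟩
    refine ⟨r + s, q + p, ?_⟩
    rw [C_add, add_mul, h, h', add_add_add_comm]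
  · intro i b
    obtain ⟨r, q, h⟩ := hpow i
    refine ⟨b * r, C b * q, ?_⟩
    have h1 : (monomial i b : OrePoly σ δ) = C b * monomial i 1 := by
      rw [C_mul_eq_smul, smul_monomial, mul_one]
    have h2 : (C (b * r) : OrePoly σ δ) = C b * C r := by
      rw [C_mul_eq_smul, C, C, smul_monomial]
    rw [h1, h, h2, mul_add, mul_assoc]

/-- The remainder on right division by `x - a` is unique. -/
theorem existsUnique_remainder (f : OrePoly σ δ) (a : R) :
    ∃! r : R, ∃ q : OrePoly σ δ, f = q * (X - C a) + C r := by
  obtain ⟨r, q, h⟩ := exists_eq_mul_X_sub_C_add_C f a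
  refine ⟨r, ⟨q, h⟩, ?_⟩
  rintro s ⟨p, h'⟩
  -- `S` is the action of `x` on `R[x; σ, δ] / R[x; σ, δ] (x - a)`, identified with `R`
  let S : AddMonoid.End R := (AddMonoidHom.mulRight a).comp σ.toAddMonoidHom + δ.toAddHom
  let ev : OrePoly σ δ →+ R := (Finsupp.liftAddHom (M := R) (N := R) fun i =>
    AddMonoidHom.mulRight ((S ^ i) 1) : (ℕ →₀ R) →+ R)
  have ev_mon : ∀ i b, ev (monomial i b) = b * (S ^ i) 1 := fun i b =>
    Finsupp.liftAddHom_apply_single _ i b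
  have ev_smul : ∀ (b : R) (u : OrePoly σ δ), ev (b • u) = b * ev u := by
    intro b u
    have : ev.comp (mulC b) = (AddMonoidHom.mulLeft b).comp ev := by
      refine hom_ext fun i c => ?_
      change ev (b • monomial i c) = b * ev (monomial i c)
      rw [smul_monomial, ev_mon, ev_mon, mul_assoc]
    exact DFunLike.congr_fun this u
  have ev_X : ∀ u : OrePoly σ δ, ev (mulX u) = S (ev u) := by
    intro u
    have : ev.comp mulX = S.comp ev := by
      refine hom_ext fun i c => ?_
      change ev (mulX (monomial i c)) = S (ev (monomial i c))
      rw [mulX_monomial, map_add, ev_mon, ev_mon, ev_mon, pow_succ']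
      change σ c * (σ ((S ^ i) 1) * a + δ ((S ^ i) 1)) + δ c * (S ^ i) 1 =
        σ (c * (S ^ i) 1) * a + δ (c * (S ^ i) 1)
      rw [map_mul, δ.leibniz]
      noncomm_ring
    exact DFunLike.congr_fun this u
  have ev_pow : ∀ (i : ℕ) (u : OrePoly σ δ), ev u = 0 → ev ((mulX ^ i) u) = 0 := by
    intro i u hu
    induction i with
    | zero => exact hu
    | succ i ih =>
      rw [pow_succ']
      change ev (mulX ((mulX ^ i) u)) = 0
      rw [ev_X, ih, map_zero]
  have ev_mul : ∀ (u v : OrePoly σ δ), ev v = 0 → ev (u * v) = 0 := by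
    intro u v hv
    have : ev.comp ((AddMonoidHom.eval v).comp mulLeft) = 0 := by
      refine hom_ext fun i c => ?_
      change ev (mulLeft (monomial i c) v) = 0
      rw [mulLeft_monomial]
      change ev (c • (mulX ^ i) v) = 0
      rw [ev_smul, ev_pow i v hv, mul_zero]
    exact DFunLike.congr_fun this u
  have ev_C : ∀ b, ev (C b) = b := fun b => by
    rw [C, ev_mon, pow_zero]; exact mul_one b
  have ev_lin : ev (X - C a) = 0 := by
    rw [map_sub, ev_C, X, ev_mon, pow_one, one_mul]
    change σ 1 * a + δ 1 - a = 0
    rw [map_one, map_one_eq_zero, one_mul, add_zero, sub_self]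
  have e1 : ev f = r := by rw [h, map_add, ev_mul _ _ ev_lin, ev_C, zero_add]
  have e2 : ev f = s := by rw [h', map_add, ev_mul _ _ ev_lin, ev_C, zero_add]
  exact e2.symm.trans e1

/-- The right evaluation `f(a)`: the unique remainder on right division of `f` by `x - a`. -/
noncomputable def rightEval (f : OrePoly σ δ) (a : R) : R :=
  (existsUnique_remainder f a).choose

/-- `a` is a right root (right zero) of `f`. -/
def IsRightRoot (f : OrePoly σ δ) (a : R) : Prop := rightEval f a = 0

end Basic

/-- `K[x; τ, ε]` is a polynomial ring extension of `F[x; σ, δ]`, where `F` is regarded as a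
subring of `K` through the embedding `ι`: `τ` extends `σ` and `ε` extends `δ`. -/
structure IsExtension {F K : Type*} [Ring F] [Ring K] (ι : F →+* K)
    {σ : F →+* F} (δ : SkewDerivation σ) {τ : K →+* K} (ε : SkewDerivation τ) : Prop where
  injective : Function.Injective ι
  map_endo : ∀ a : F, τ (ι a) = ι (σ a)
  map_derivation : ∀ a : F, ε (ι a) = ι (δ a)

/-- The skew polynomial over `F` regarded as a skew polynomial over `K`, coefficientwise through
`ι : F →+* K`. -/
noncomputable def mapCoeff {F K : Type*} [Ring F] [Ring K] (ι : F →+* K)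
    {σ : F →+* F} {δ : SkewDerivation σ} {τ : K →+* K} {ε : SkewDerivation τ}
    (f : OrePoly σ δ) : OrePoly τ ε :=
  (show ℕ →₀ F from f).mapRange ι (map_zero ι)

section Resultant

variable {R : Type*} [Ring R] {σ : R →+* R}

/-- The sum, evaluated at `a`, of all compositions of `d` copies of `δ` and `s` copies of `σ`.
The sum is organized by the outermost factor of each composition. -/
def sumComp (δ : SkewDerivation σ) : ℕ → ℕ → R → R
  | 0, 0, a => a
  | d + 1, 0, a => δ (sumComp δ d 0 a)
  | 0, s + 1, a => σ (sumComp δ 0 s a)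
  | d + 1, s + 1, a => δ (sumComp δ d (s + 1) a) + σ (sumComp δ (d + 1) s a)

/-- The entry in column `q` of the `p`-th row attached to `f = ∑ aⱼ xʲ` in the Sylvester matrix,
`∑ₗ C_{p-l,l}(a_{q-l})`, over `0 ≤ l ≤ p` with `q - l ≥ 0`. Here `C_{d,s}` is `sumComp δ d s`;
rows and columns are counted from `0`. -/
def sylvesterEntry {δ : SkewDerivation σ} (f : OrePoly σ δ) (p q : ℕ) : R :=
  ∑ l ∈ Finset.range (p + 1), if l ≤ q then sumComp δ (p - l) l (f.coeff (q - l)) else 0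

/-- The right Sylvester matrix of `f` and `g`, of degrees `m` and `n`: a square matrix of size
`n + m`, whose first `n` rows come from `f` and whose last `m` rows come from `g`. -/
def sylvester {δ : SkewDerivation σ} (f g : OrePoly σ δ) :
    Matrix (Fin (g.natDegree + f.natDegree)) (Fin (g.natDegree + f.natDegree)) R :=
  Matrix.of fun i q =>
    Fin.addCases (fun p : Fin g.natDegree => sylvesterEntry f p q)
      (fun p : Fin f.natDegree => sylvesterEntry g p q) i

end Resultant

end OrePoly

open Classical in
/-- The Dieudonné determinant of a square matrix over a division ring `F`, with values in
`{0} ∪ Fˣ / [Fˣ, Fˣ]`, computed by elimination. If the first column is zero, the determinant is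
`0`. Otherwise let `i` be the first row with a non-zero entry `u` in the first column; left
multiples of row `i` are subtracted from the other rows to clear the first column, and the
determinant is the class of `(-1)ⁱ u` times the determinant of the matrix left after removing
row `i` and the first column (rows are counted from `0`, and moving row `i` to the top
costs the sign `(-1)ⁱ`). -/
noncomputable def dieudonneDet {F : Type*} [DivisionRing F] :
    (n : ℕ) → Matrix (Fin n) (Fin n) F → WithZero (Abelianization Fˣ)
  | 0, _ => 1
  | n + 1, A =>
    if h : ∃ i, A i 0 ≠ 0 then
      let i : Fin (n + 1) := Fin.find (fun i => A i 0 ≠ 0) h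
      let u : Fˣ := Units.mk0 (A i 0) (Fin.find_spec h)
      ((Abelianization.of ((-1) ^ (i : ℕ) * u) : Abelianization Fˣ) :
          WithZero (Abelianization Fˣ)) *
        dieudonneDet n (Matrix.of fun r c =>
          A (i.succAbove r) c.succ - A (i.succAbove r) 0 * (A i 0)⁻¹ * A i c.succ)
    else 0

/-- The right `(σ, δ)`-resultant of `f` and `g`. -/
noncomputable def OrePoly.resultant {F : Type*} [DivisionRing F] {σ : F →+* F}
    {δ : SkewDerivation σ} (f g : OrePoly σ δ) : WithZero (Abelianization Fˣ) :=
  dieudonneDet (g.natDegree + f.natDegree) (OrePoly.sylvester f g)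

/-! A common right root produces a nonzero column vector annihilated by the Sylvester matrix. Its
entries `v_q` are the right values of `x^q` at `α`; in particular `v_0 = 1`. The rows of the matrix
are the coefficient families of `x^p f` for `p < n` and `x^p g` for `p < m`
(`sylvesterEntry_eq_coeff`). Right evaluation is left linear, so row times `v` is the value of that
polynomial at `α` (`rightEval_eq_sum`). This value is `0`, because the multiples of `x - α` form a
left ideal (`IsRightRoot.mulX`). The vector lives over a ring `K` in which division may fail.
Elimination divides only by entries from `F`, however, so it suffices that `K` is a left `F`-vector
space (`dieudonneDet_eq_zero_of_sum_smul_eq_zero`). -/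

namespace OrePoly

/-! ### Coefficients of `x^p f` and the rows of the Sylvester matrix -/

section Coefficients

variable {R : Type*} [Ring R] {σ : R →+* R} {δ : SkewDerivation σ}

theorem coeff_ext {f g : OrePoly σ δ} (h : ∀ i, f.coeff i = g.coeff i) : f = g :=
  Finsupp.ext (f := f) (g := g) h

theorem coeff_add (f g : OrePoly σ δ) (i : ℕ) : (f + g).coeff i = f.coeff i + g.coeff i :=
  Finsupp.add_apply _ _ _

theorem coeff_zero (i : ℕ) : (0 : OrePoly σ δ).coeff i = 0 := rfl

theorem coeff_monomial (i j : ℕ) (a : R) :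
    (monomial i a : OrePoly σ δ).coeff j = if i = j then a else 0 :=
  Finsupp.single_apply

theorem coeff_mulX_zero (f : OrePoly σ δ) : (mulX f).coeff 0 = δ (f.coeff 0) := by
  induction f using induction_linear with
  | zero => rw [map_zero, coeff_zero]; exact (map_zero δ.toAddHom).symm
  | add f g hf hg => rw [map_add, coeff_add, coeff_add, hf, hg]; exact (map_add δ.toAddHom _ _).symm
  | mono i a =>
    rw [mulX_monomial, coeff_add, coeff_monomial, coeff_monomial, coeff_monomial]
    split_ifs <;> simp_all

/-- In `x a = σ a x + δ a`, the `δ` part stays in its column and the `σ` part moves one column to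
the right. -/
theorem coeff_mulX_succ (f : OrePoly σ δ) (q : ℕ) :
    (mulX f).coeff (q + 1) = δ (f.coeff (q + 1)) + σ (f.coeff q) := by
  induction f using induction_linear with
  | zero => rw [map_zero]; simp only [coeff_zero, map_zero, add_zero]
  | add f g hf hg =>
    rw [map_add, coeff_add, coeff_add, coeff_add, hf, hg, map_add, map_add]; abel
  | mono i a =>
    rw [mulX_monomial, coeff_add, coeff_monomial, coeff_monomial, coeff_monomial, coeff_monomial,
      add_comm]
    simp only [Nat.add_right_cancel_iff]
    congr 1 <;> split_ifs <;> simp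

theorem coeff_eq_zero_of_natDegree_lt {f : OrePoly σ δ} {i : ℕ} (h : f.natDegree < i) :
    f.coeff i = 0 := by
  by_contra hne
  exact absurd (Finset.le_sup (f := id) (Finsupp.mem_support_iff.mpr hne)) (not_le.mpr h)

theorem mulX_pow_succ_apply (p : ℕ) (f : OrePoly σ δ) :
    (mulX ^ (p + 1)) f = mulX ((mulX ^ p) f) := by
  rw [pow_succ']; rfl

theorem coeff_mulX_pow_eq_zero (f : OrePoly σ δ) (p i : ℕ) (h : f.natDegree + p < i) :
    ((mulX ^ p) f).coeff i = 0 := by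
  induction p generalizing i with
  | zero => exact coeff_eq_zero_of_natDegree_lt h
  | succ p ih =>
    obtain ⟨i, rfl⟩ : ∃ j, i = j + 1 := ⟨i - 1, by omega⟩
    rw [mulX_pow_succ_apply, coeff_mulX_succ, ih _ (by omega), ih _ (by omega), map_zero, map_zero,
      add_zero]

theorem eq_sum_monomial (f : OrePoly σ δ) (N : ℕ) (h : ∀ i, N ≤ i → f.coeff i = 0) :
    f = ∑ i : Fin N, monomial i (f.coeff i) := by
  refine coeff_ext fun j => ?_
  let c : OrePoly σ δ →+ R := ⟨⟨fun f => f.coeff j, coeff_zero j⟩, fun f g => coeff_add f g j⟩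
  change c f = c _
  rw [map_sum, Fin.sum_univ_eq_sum_range (fun i => c (monomial i (f.coeff i))) N]
  have : ∀ i, c (monomial i (f.coeff i)) = if i = j then f.coeff i else 0 :=
    fun i => coeff_monomial (σ := σ) (δ := δ) i j _
  simp only [this, Finset.sum_ite_eq', Finset.mem_range]
  split_ifs with hj
  · rfl
  · exact h j (not_lt.mp hj)

/-- The coefficient of `x^q` in the sum of the terms of `x^(d+s) f` in which `d` of the factors `x`
act through `δ` and the other `s` through `σ`. -/
def shiftedSumComp (f : OrePoly σ δ) (d s q : ℕ) : R :=
  if s ≤ q then sumComp δ d s (f.coeff (q - s)) else 0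

theorem shiftedSumComp_succ_zero (f : OrePoly σ δ) (d q : ℕ) :
    shiftedSumComp f (d + 1) 0 q = δ (shiftedSumComp f d 0 q) := by
  simp [shiftedSumComp, sumComp]

theorem shiftedSumComp_succ_col_zero (f : OrePoly σ δ) (d s : ℕ) :
    shiftedSumComp f d (s + 1) 0 = 0 := by
  simp [shiftedSumComp]

theorem shiftedSumComp_zero_succ (f : OrePoly σ δ) (s q : ℕ) :
    shiftedSumComp f 0 (s + 1) (q + 1) = σ (shiftedSumComp f 0 s q) := by
  simp only [shiftedSumComp, Nat.add_le_add_iff_right, Nat.add_sub_add_right, sumComp]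
  split_ifs <;> simp

/-- The outermost factor is either `δ` or `σ`. The guards `s + 1 ≤ q + 1` and `s ≤ q` agree, so all
three terms vanish together outside the range. -/
theorem shiftedSumComp_succ_succ (f : OrePoly σ δ) (d s q : ℕ) :
    shiftedSumComp f (d + 1) (s + 1) (q + 1) =
      δ (shiftedSumComp f d (s + 1) (q + 1)) + σ (shiftedSumComp f (d + 1) s q) := by
  simp only [shiftedSumComp, Nat.add_le_add_iff_right, Nat.add_sub_add_right, sumComp]
  split_ifs <;> simp

theorem sylvesterEntry_eq_sum_antidiagonal (f : OrePoly σ δ) (p q : ℕ) :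
    sylvesterEntry f p q =
      ∑ x ∈ Finset.HasAntidiagonal.antidiagonal p, shiftedSumComp f x.2 x.1 q :=
  (Finset.Nat.sum_antidiagonal_eq_sum_range_succ (fun s d => shiftedSumComp f d s q) p).symm

theorem sylvesterEntry_succ_zero (f : OrePoly σ δ) (p : ℕ) :
    sylvesterEntry f (p + 1) 0 = δ (sylvesterEntry f p 0) := by
  simp only [sylvesterEntry, Nat.le_zero]
  simp [sumComp]

/-- Sorting the words of length `p + 1` by outermost factor gives the same recursion as
`coeff_mulX_succ`. -/
theorem sylvesterEntry_succ_succ (f : OrePoly σ δ) (p q : ℕ) :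
    sylvesterEntry f (p + 1) (q + 1) =
      δ (sylvesterEntry f p (q + 1)) + σ (sylvesterEntry f p q) := by
  -- `D` collects the words that begin with `δ`, `S` those that begin with `σ`. Each is `0` where no
  -- such factor is available, so peeling that end off the antidiagonal of `p + 1` leaves a sum over
  -- the antidiagonal of `p`.
  let D : ℕ → ℕ → R := fun s d => Nat.casesOn d 0 fun d => δ (shiftedSumComp f d s (q + 1))
  let S : ℕ → ℕ → R := fun s d => Nat.casesOn s 0 fun s => σ (shiftedSumComp f d s q)
  have split : ∀ x ∈ Finset.HasAntidiagonal.antidiagonal (p + 1),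
      shiftedSumComp f x.2 x.1 (q + 1) = D x.1 x.2 + S x.1 x.2 := by
    rintro ⟨s, d⟩ hx
    rcases s with _ | s <;> rcases d with _ | d
    · simp at hx
    · exact (shiftedSumComp_succ_zero f d (q + 1)).trans (add_zero _).symm
    · exact (shiftedSumComp_zero_succ f s q).trans (zero_add _).symm
    · exact shiftedSumComp_succ_succ f d s q
  rw [sylvesterEntry_eq_sum_antidiagonal, Finset.sum_congr rfl split, Finset.sum_add_distrib,
    Finset.Nat.sum_antidiagonal_succ', Finset.Nat.sum_antidiagonal_succ,
    sylvesterEntry_eq_sum_antidiagonal, sylvesterEntry_eq_sum_antidiagonal, map_sum, map_sum]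
  simp [D, S]

/-- The rows of the Sylvester matrix are the coefficient families of the `x^p f`. -/
theorem sylvesterEntry_eq_coeff (f : OrePoly σ δ) (p q : ℕ) :
    sylvesterEntry f p q = ((mulX ^ p) f).coeff q := by
  induction p generalizing q with
  | zero => simp [sylvesterEntry, sumComp]
  | succ p ih =>
    rw [mulX_pow_succ_apply]
    cases q with
    | zero => rw [coeff_mulX_zero, sylvesterEntry_succ_zero, ih]
    | succ q => rw [coeff_mulX_succ, sylvesterEntry_succ_succ, ih, ih]

end Coefficients

/-! ### Left linearity of right evaluation -/

section RightEval

variable {R : Type*} [Ring R] {σ : R →+* R} {δ : SkewDerivation σ}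

theorem exists_eq_mul_add_rightEval (f : OrePoly σ δ) (a : R) :
    ∃ q : OrePoly σ δ, f = q * (X - C a) + C (rightEval f a) :=
  (existsUnique_remainder f a).choose_spec.1

theorem rightEval_eq_of_eq {f q : OrePoly σ δ} {a r : R} (h : f = q * (X - C a) + C r) :
    rightEval f a = r :=
  (existsUnique_remainder f a).unique (exists_eq_mul_add_rightEval f a) ⟨q, h⟩

theorem rightEval_C (a r : R) : rightEval (C r : OrePoly σ δ) a = r :=
  rightEval_eq_of_eq (q := 0) (by rw [zero_mul, zero_add])

theorem rightEval_add (f g : OrePoly σ δ) (a : R) :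
    rightEval (f + g) a = rightEval f a + rightEval g a := by
  obtain ⟨q, hq⟩ := exists_eq_mul_add_rightEval f a
  obtain ⟨p, hp⟩ := exists_eq_mul_add_rightEval g a
  apply rightEval_eq_of_eq (q := q + p)
  rw [C_add, add_mul, add_add_add_comm, ← hq, ← hp]

/-- Right evaluation at `a`, as an additive map. -/
noncomputable def rightEvalHom (a : R) : OrePoly σ δ →+ R :=
  AddMonoidHom.mk' (fun f => rightEval f a) fun f g => rightEval_add f g a

/-- Multiplying a division by `x - a` on the left by `b` multiplies quotient and remainder by `b`.
-/
theorem rightEval_monomial (i : ℕ) (a b : R) :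
    rightEval (monomial i b : OrePoly σ δ) a = b * rightEval (monomial i 1 : OrePoly σ δ) a := by
  obtain ⟨q, hq⟩ := exists_eq_mul_add_rightEval (monomial i 1 : OrePoly σ δ) a
  apply rightEval_eq_of_eq (q := C b * q)
  have h : (C (b * rightEval (monomial i 1 : OrePoly σ δ) a) : OrePoly σ δ) =
      C b * C (rightEval (monomial i 1 : OrePoly σ δ) a) := by
    rw [C_mul_eq_smul, C, C, smul_monomial]
  rw [h, mul_assoc, ← mul_add, ← hq, C_mul_eq_smul, smul_monomial, mul_one]

theorem IsRightRoot.mulX {f : OrePoly σ δ} {a : R} (h : IsRightRoot f a) :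
    IsRightRoot (mulX f) a := by
  obtain ⟨q, hq⟩ := exists_eq_mul_add_rightEval f a
  have h0 : (C 0 : OrePoly σ δ) = 0 := map_zero (monomial 0)
  rw [show rightEval f a = 0 from h, h0, add_zero] at hq
  apply rightEval_eq_of_eq (q := X * q)
  rw [h0, add_zero, mul_assoc, ← hq, X_mul_eq_mulX]

theorem IsRightRoot.mulX_pow {f : OrePoly σ δ} {a : R} (h : IsRightRoot f a) (p : ℕ) :
    IsRightRoot ((OrePoly.mulX ^ p) f) a := by
  induction p with
  | zero => exact h
  | succ p ih => rw [mulX_pow_succ_apply]; exact ih.mulX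

/-- The bound `N` is free, so that polynomials of different degrees pair with one and the same
vector of values of powers of `x`. -/
theorem rightEval_eq_sum (f : OrePoly σ δ) (a : R) (N : ℕ) (h : ∀ i, N ≤ i → f.coeff i = 0) :
    rightEval f a = ∑ i : Fin N, f.coeff i * rightEval (monomial i 1 : OrePoly σ δ) a := by
  change rightEvalHom a f = _
  conv_lhs => rw [eq_sum_monomial f N h, map_sum]
  exact Finset.sum_congr rfl fun i _ => rightEval_monomial _ _ _

end RightEval

/-! ### Passage to the extension ring -/

section Extension

variable {F K : Type*} [Ring F] [Ring K] {ι : F →+* K} {σ : F →+* F} {δ : SkewDerivation σ}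
  {τ : K →+* K} {ε : SkewDerivation τ}

theorem coeff_mapCoeff (f : OrePoly σ δ) (i : ℕ) :
    (mapCoeff ι f : OrePoly τ ε).coeff i = ι (f.coeff i) := rfl

/-- The coefficients of `x f` involve only `σ` and `δ`, which `ι` intertwines with `τ` and `ε`. The
rows need no products other than by powers of `x`. -/
theorem IsExtension.mapCoeff_mulX (hext : IsExtension ι δ ε) (f : OrePoly σ δ) :
    (mapCoeff ι (mulX f) : OrePoly τ ε) = mulX (mapCoeff ι f) := by
  refine coeff_ext fun q => ?_
  cases q with
  | zero =>
    rw [coeff_mapCoeff, coeff_mulX_zero, coeff_mulX_zero, coeff_mapCoeff, hext.map_derivation]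
  | succ q =>
    rw [coeff_mapCoeff, coeff_mulX_succ, coeff_mulX_succ, coeff_mapCoeff, coeff_mapCoeff,
      hext.map_derivation, hext.map_endo, map_add]

theorem IsExtension.mapCoeff_mulX_pow (hext : IsExtension ι δ ε) (p : ℕ) (f : OrePoly σ δ) :
    (mapCoeff ι ((mulX ^ p) f) : OrePoly τ ε) = (mulX ^ p) (mapCoeff ι f) := by
  induction p with
  | zero => rfl
  | succ p ih => rw [mulX_pow_succ_apply, mulX_pow_succ_apply, hext.mapCoeff_mulX, ih]

/-- The values at a right root `α` of `f` of the powers of `x` are annihilated by the rows of the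
Sylvester matrix attached to `f`. -/
theorem IsExtension.sum_sylvesterEntry_mul_eq_zero (hext : IsExtension ι δ ε) {f : OrePoly σ δ}
    {α : K} (h : IsRightRoot (mapCoeff ι f : OrePoly τ ε) α) {p N : ℕ}
    (hN : f.natDegree + p < N) :
    ∑ q : Fin N, ι (sylvesterEntry f p q) * rightEval (monomial q 1 : OrePoly τ ε) α = 0 := by
  have key : rightEval (mapCoeff ι ((OrePoly.mulX ^ p) f) : OrePoly τ ε) α = 0 := by
    rw [hext.mapCoeff_mulX_pow]
    exact h.mulX_pow p
  rw [rightEval_eq_sum _ α N fun i hi => by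
    rw [coeff_mapCoeff, coeff_mulX_pow_eq_zero f p i (hN.trans_le hi), map_zero]] at key
  simpa only [sylvesterEntry_eq_coeff, coeff_mapCoeff] using key

end Extension

end OrePoly

/-! ### Elimination on a singular matrix -/

open Classical in
/-- A square matrix over a division ring that annihilates a nonzero vector, with entries in any left
vector space, has Dieudonné determinant `0`. -/
theorem dieudonneDet_eq_zero_of_sum_smul_eq_zero {F V : Type*} [DivisionRing F] [AddCommGroup V]
    [Module F V] (n : ℕ) (A : Matrix (Fin n) (Fin n) F) (v : Fin n → V) (hv : v ≠ 0)
    (h : ∀ i, ∑ q, A i q • v q = 0) : dieudonneDet n A = 0 := by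
  induction n with
  | zero => exact absurd (Subsingleton.elim v 0) hv
  | succ n ih =>
    rw [dieudonneDet]
    split_ifs with hp
    · have hu := Fin.find_spec hp
      set i : Fin (n + 1) := Fin.find (fun i => A i 0 ≠ 0) hp
      have hi := h i
      rw [Fin.sum_univ_succ] at hi
      -- The pivot is invertible, so the pivot row expresses `v 0` through the other entries.
      have hv0 : v 0 = -((A i 0)⁻¹ • ∑ c : Fin n, A i c.succ • v c.succ) := by
        rw [← smul_neg, ← eq_neg_of_add_eq_zero_left hi, smul_smul, inv_mul_cancel₀ hu, one_smul]
      refine mul_eq_zero_of_right _ (ih _ (fun c => v c.succ) ?_ ?_)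
      -- If the remaining entries were all zero, `v 0` would vanish too.
      · intro h0
        have h0' : ∀ c : Fin n, v c.succ = 0 := fun c => congrFun h0 c
        refine hv (funext fun q => Fin.cases ?_ h0' q)
        simp [hv0, h0']
      -- Substituting for `v 0` in another row gives precisely the row of the reduced matrix applied
      -- to the shortened vector.
      · intro r
        have hr := h (i.succAbove r)
        rw [Fin.sum_univ_succ, hv0] at hr
        simp only [Matrix.of_apply, sub_smul, Finset.sum_sub_distrib]
        simp only [mul_smul, ← Finset.smul_sum]
        rw [smul_neg, neg_add_eq_sub] at hr
        exact hr
    · rfl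

/-! ### Vanishing of the resultant -/

theorem corollary3p16 {F : Type*} [DivisionRing F] (σ : F →+* F) (δ : SkewDerivation σ)
    (f g : OrePoly σ δ) (hf : 0 < f.natDegree) (hg : 0 < g.natDegree)
    {K : Type*} [Ring K] (ι : F →+* K) (τ : K →+* K) (ε : SkewDerivation τ)
    (hext : OrePoly.IsExtension ι δ ε)
    (hroot : ∃ α : K, OrePoly.IsRightRoot (OrePoly.mapCoeff ι f : OrePoly τ ε) α ∧
      OrePoly.IsRightRoot (OrePoly.mapCoeff ι g : OrePoly τ ε) α) :
    OrePoly.resultant f g = 0 := by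
  obtain ⟨α, hαf, hαg⟩ := hroot
  let : Module F K := Module.compHom K ι
  refine dieudonneDet_eq_zero_of_sum_smul_eq_zero _ _
    (fun q => OrePoly.rightEval (OrePoly.monomial q 1 : OrePoly τ ε) α) ?_ ?_
  · intro h
    -- Column `0` exists because the degrees are positive, and its entry is the value of `x^0 = 1`.
    -- Injectivity of `ι` makes `1 ≠ 0` in `K`.
    have h1 : OrePoly.rightEval (OrePoly.C 1 : OrePoly τ ε) α = 0 :=
      congrFun h ⟨0, Nat.add_pos_left hg _⟩
    rw [OrePoly.rightEval_C] at h1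
    exact one_ne_zero (hext.injective (by rw [map_one, map_zero, h1]))
  · intro i
    change ∑ q, ι (OrePoly.sylvester f g i q) * _ = 0
    -- Rows of `f` have `p < n` and rows of `g` have `p < m`, so `x^p f` and `x^p g` have degree
    -- below `n + m` and fit in the columns.
    refine Fin.addCases (fun p => ?_) (fun p => ?_) i
    · simp only [OrePoly.sylvester, Matrix.of_apply, Fin.addCases_left]
      exact hext.sum_sylvesterEntry_mul_eq_zero hαf (by omega)
    · simp only [OrePoly.sylvester, Matrix.of_apply, Fin.addCases_right]
      exact hext.sum_sylvesterEntry_mul_eq_zero hαg (by omega)
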